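/- **Setting.** Let $\Sigma=\langle R,D\rangle$ be a relational alphabet ($R$ a finite set of relation symbols with arities, $D$ a possibly infinite set of constants), $\mathit{Var}$ a countably infinite set of variables and $\mathit{AR}$ the set of atoms over constants and variables. An abstract state is a set $e\subseteq \mathit{AR}$. OI-subsumption $C\preceq C'$ means $C'\theta\subseteq C$ for some substitution $\theta$ that is injective on the terms of $C'$. Let $K$ be a relational MDP over $\Sigma$: the relations are divided into state and action relations, and there are finitely many abstract actions, each with an action atom, a precondition $B$ and finitely many outcomes $H_i$ with probabilities $p_i$, $\sum_i p_i=1$. In the ground MDP the states $s$ are the Herbrand interpretations over the state relations; a ground instance (under object identity) whose precondition $B\theta$ is contained in $s$ can be taken in $s$ and leads to $(s\setminus B\theta)\cup H_i\theta$ with probability $p_i$; a state in which nothing can be taken persists. Fix $\alpha\in[0,1]$ and $k\in\mathbb N$. $L^{\mathsf{FG}}$ is the set of formulae $\Psi=\mathsf P_{\ge\alpha}\mathsf{Op}^{\le k}\phi$ with $\mathsf{Op}\in\{\mathsf F,\mathsf G\}$ and $\phi$ a nonempty finite set of atoms in $\mathit{AR}$; $\mathrm{length}(\Psi)=|\phi|$.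 $s\models\Psi$ iff for some substitution $\theta$ that grounds all variables of $\phi$ and is injective on its terms, the supremum over all history-dependent randomized policies of the probability that the path $s_0=s,s_1,\dots,s_k$ satisfies "$\phi\theta\subseteq s_i$ for some $i\le k$" (for $\mathsf F$), respectively "for all $i\le k$" (for $\mathsf G$), is at least $\alpha$. Given sets $E^+,E^-$ of abstract states, $\Psi$ is *consistent* with $E=(E^+,E^-)$ iff every state $s\preceq e$ with $e\in E^+$ satisfies $\Psi$ and no state $s\preceq e$ with $e\in E^-$ satisfies $\Psi$. $\mathit{Sat}_K(\Psi)$ is the set of abstract states $e$ such that every state $s\preceq e$ satisfies $\Psi$. **Refinement.** Let $\top$ be the empty formula, satisfied by all states, with operator $\mathsf F$, and write $\Psi'\preceq_{\mathsf{FG}}\Psi$ if every state satisfying $\Psi'$ satisfies $\Psi$. A refinement operator $\rho$ assigns to $\top$ and to each formula a set of formulae in $L^{\mathsf{FG}}$, each obtained by one of the following operations (to avoid duplicates, $\rho$ may omit some results): *Len*: add to $\phi$ one atom with pairwise different fresh variables, optionally unifying variables of that atom with variables or constants already present (*Uni*), the resulting atom being new; *Ins*: replace one variable by a constant not occurring in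 $\phi$; *Glo*: replace $\mathsf F$ by $\mathsf G$ (not applied to $\top$). $\rho$ is *complete* if $\bigcup_{r\ge0}\rho^r(\top)=\{\Psi'\mid\Psi'\preceq_{\mathsf{FG}}\top\}$, and *complete up to renaming* if $\bigcup_{r\ge0}\rho^r(\top)$ contains a variant (a formula differing only by a renaming of variables) of each $\Psi\in L^{\mathsf{FG}}$. **Algorithm.** A set of *sensible* formulae is given. Learn-pCTL calls $\mathrm{Search}(\Psi)$ for each $\Psi\in\rho(\top)$ (these are lengthenings of $\top$) and returns all solutions found. If $\Psi$ is sensible and every $e\in E^+$ satisfies $e\preceq e'$ for some $e'\in\mathit{Sat}_K(\Psi)$, then $\mathrm{Search}(\Psi)$ (i) adds $\Psi$ to the solutions if no $e\in E^-$ satisfies $e\preceq e'$ for some $e'\in\mathit{Sat}_K(\Psi)$, and (ii) calls $\mathrm{Search}(\Psi')$ for all $\Psi'\in\rho(\Psi)$ that pass the length test. The length test is $\mathrm{length}(\Psi')\le\ell$: no candidate longer than $\ell$ is generated. With the *strict* test, refinements are instead searched only if $\mathrm{length}(\Psi)<\ell$. A formula is *generated* if Search is called on it. **Theorem (Completeness).**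 Assume that each $e\in E^-$ represents at least one state ($s\preceq e$ for some $s$), and that whenever $\Psi'\in\rho(\Psi)$ is sensible for a formula $\Psi$, so is $\Psi$ (both are automatic, for instance, if $E^-$ consists of states and all formulae are sensible). Let $\ell\in\mathbb N$. 1. If $\rho$ is complete, then every sensible $\Psi\in L^{\mathsf{FG}}$ of length $m\le\ell$ that is consistent with $E$ is generated and returned by Learn-pCTL. If $m<\ell$, the same holds for Learn-pCTL with the strict test. 2. If $\rho$ is complete up to renaming, and variants of sensible formulae are sensible, then for every sensible $\Psi\in L^{\mathsf{FG}}$ of length $m\le\ell$ that is consistent with $E$, a variant of $\Psi$ is generated and returned by Learn-pCTL. If $m<\ell$, the same holds for Learn-pCTL with the strict test. -/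

import Mathlib

open scoped NNReal ENNReal

universe u

namespace LearnPCTL

/-! ### Relational logic -/

/-- An alphabet `⟨R, D⟩`: finitely many relation symbols with arities, and a possibly infinite
domain of constants. -/
structure Alphabet where
  R : Type u
  D : Type u
  arity : R → ℕ
  finite_R : Finite R

/-- Terms: variables (the countably infinite set `Var` is `ℕ`) and constants. -/
inductive Term (A : Alphabet.{u}) where
  | var : ℕ → Term A
  | const : A.D → Term A

/-- Atoms over a set `T` of arguments. `Atom A A.D` is the Herbrand base,
`Atom A (Term A)` is the set `AR` of (partially ground) atomic relations. -/
structure Atom (A : Alphabet.{u}) (T : Type u) where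
  rel : A.R
  args : Fin (A.arity rel) → T

/-- Apply a map to all arguments of an atom. -/
def Atom.map {A : Alphabet.{u}} {T T' : Type u} (f : T → T') (a : Atom A T) : Atom A T' :=
  ⟨a.rel, fun i => f (a.args i)⟩

/-- Substitutions: simultaneous bindings of variables to terms (unbound variables are mapped to
themselves). -/
abbrev Subst (A : Alphabet.{u}) := ℕ → Term A

/-- Apply a substitution to a term. -/
def Term.subst {A : Alphabet.{u}} (θ : Subst A) : Term A → Term A
  | .var x => θ x
  | .const c => .const c

/-- `aθ`. -/
def Atom.subst {A : Alphabet.{u}} (θ : Subst A) (a : Atom A (Term A)) : Atom A (Term A) :=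
  a.map (Term.subst θ)

/-- A ground atom regarded as an element of `AR`. -/
def Atom.ofGround {A : Alphabet.{u}} (a : Atom A A.D) : Atom A (Term A) := a.map Term.const

/-- The arguments that occur in a set of atoms: `terms(C)`. -/
def termsOf {A : Alphabet.{u}} {T : Type u} (C : Set (Atom A T)) : Set T :=
  {t | ∃ a ∈ C, ∃ i, a.args i = t}

/-- `vars(C)`. -/
def varsOf {A : Alphabet.{u}} (C : Set (Atom A (Term A))) : Set ℕ :=
  {x | Term.var x ∈ termsOf C}

/-- `consts(C)`. -/
def constsOf {A : Alphabet.{u}} (C : Set (Atom A (Term A))) : Set A.D :=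
  {c | Term.const c ∈ termsOf C}

/-- Abstract states: conjunctions (sets) of atoms in `AR`. -/
abbrev AbstractState (A : Alphabet.{u}) := Set (Atom A (Term A))

/-- Object identity: `θ` keeps different terms of `C` different. -/
def ObjectIdentity {A : Alphabet.{u}} (θ : Subst A) (C : Set (Atom A (Term A))) : Prop :=
  Set.InjOn (Term.subst θ) (termsOf C)

/-- OI-subsumption `C ≼ C'`: `C'θ ⊆ C` for some substitution `θ`, under object identity. -/
def OISubsumed {A : Alphabet.{u}} (C C' : Set (Atom A (Term A))) : Prop :=
  ∃ θ : Subst A, ObjectIdentity θ C' ∧ Atom.subst θ '' C' ⊆ C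

/-! ### Relational MDPs -/

/-- The transition rules of one abstract action: the action atom `act`, the precondition `body`,
and finitely many outcomes, that is, the rules `head i ←(prob i : act)— body`, whose
probabilities add up to one. -/
structure ActionRule (A : Alphabet.{u}) (T : Type u) where
  act : Atom A T
  body : Set (Atom A T)
  n : ℕ
  prob : Fin n → ℝ≥0
  head : Fin n → Set (Atom A T)
  sum_prob : ∑ i, prob i = 1

/-- Apply a map to all arguments in an action rule. -/
def ActionRule.map {A : Alphabet.{u}} {T T' : Type u} (f : T → T') (r : ActionRule A T) :
    ActionRule A T' :=
  ⟨r.act.map f, Atom.map f '' r.body, r.n, r.prob, fun i => Atom.map f '' r.head i, r.sum_prob⟩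

/-- All atoms of an action rule. -/
def ActionRule.atoms {A : Alphabet.{u}} {T : Type u} (r : ActionRule A T) : Set (Atom A T) :=
  {r.act} ∪ r.body ∪ ⋃ i, r.head i

/-- Preconditions and outcomes use state relations only (those in `P`), the action atom uses an
action relation. -/
def ActionRule.Typed {A : Alphabet.{u}} {T : Type u} (P : Set A.R) (r : ActionRule A T) :
    Prop :=
  r.act.rel ∉ P ∧ (∀ a ∈ r.body, a.rel ∈ P) ∧ ∀ i, ∀ a ∈ r.head i, a.rel ∈ P

theorem ActionRule.typed_map {A : Alphabet.{u}} {T T' : Type u} (P : Set A.R) (f : T → T')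
    (r : ActionRule A T) : (r.map f).Typed P ↔ r.Typed P := by
  simp [ActionRule.Typed, ActionRule.map, Atom.map]

/-- A (non-rewarding) relational MDP `⟨Σ, Δ⟩`: a division of the relation symbols into state
relations and action relations, and a finite family of transition rules, grouped by abstract
action. -/
structure RMDP (A : Alphabet.{u}) where
  stateRel : Set A.R
  rules : List (ActionRule A (Term A))
  typed : ∀ r ∈ rules, r.Typed stateRel

variable {A : Alphabet.{u}}

/-- The states of the underlying ground MDP: Herbrand interpretations that involve only state
relations. -/
def RMDP.State (K : RMDP A) := {s : Set (Atom A A.D) // ∀ a ∈ s, a.rel ∈ K.stateRel}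

/-- A state regarded as a (ground) conjunction. -/
def RMDP.State.conj {K : RMDP A} (s : K.State) : AbstractState A := Atom.ofGround '' s.1

/-- `g` is a ground instance, under object identity, of a rule of the RMDP. -/
def RMDP.IsInstance (K : RMDP A) (g : ActionRule A A.D) : Prop :=
  ∃ r ∈ K.rules, ∃ θ : Subst A,
    ObjectIdentity θ r.atoms ∧ r.map (Term.subst θ) = g.map Term.const

/-- The ground actions that can be taken in `s`: ground instances of action rules whose
precondition holds in `s`. -/
def RMDP.Enabled (K : RMDP A) (s : K.State) :=
  {g : ActionRule A A.D // K.IsInstance g ∧ g.body ⊆ s.1}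

theorem RMDP.IsInstance.typed {K : RMDP A} {g : ActionRule A A.D} (h : K.IsInstance g) :
    g.Typed K.stateRel := by
  obtain ⟨r, hr, θ, -, e⟩ := h
  rw [← ActionRule.typed_map K.stateRel Term.const g, ← e, ActionRule.typed_map]
  exact K.typed r hr

/-- The state `(s \ body) ∪ head i` that results from the `i`-th outcome of a ground action. -/
def RMDP.successor (K : RMDP A) (s : K.State) (g : K.Enabled s) (i : Fin g.1.n) : K.State :=
  ⟨(s.1 \ g.1.body) ∪ g.1.head i, by
    rintro a (ha | ha)
    · exact s.2 a ha.1
    · exact g.2.1.typed.2.2 i a ha⟩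

/-- The transition function of the ground MDP. -/
noncomputable def RMDP.trans (K : RMDP A) (s : K.State) (g : K.Enabled s) : PMF K.State :=
  (PMF.ofFintype (fun i => (g.1.prob i : ℝ≥0∞)) (by
    rw [← ENNReal.ofNNReal_finsetSum, g.1.sum_prob]; rfl)).map (K.successor s g)

/-- (Stochastic, non-Markovian) policies: given the list of the earlier states and the current
state, a distribution on the enabled ground actions, whenever there are any. -/
def RMDP.Policy (K : RMDP A) :=
  (h : List K.State) → (s : K.State) → Nonempty (K.Enabled s) → PMF (K.Enabled s)

open Classical in
/-- The law of the next state under a policy; where no action is enabled the state persists. -/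
noncomputable def RMDP.Policy.next {K : RMDP A} (π : K.Policy) (h : List K.State) (s : K.State) :
    PMF K.State :=
  if hs : Nonempty (K.Enabled s) then (π h s hs).bind (K.trans s) else PMF.pure s

/-- The law of the path `s₀ = s, s₁, …, s_n` under a policy, after the earlier states `h`. -/
noncomputable def RMDP.Policy.pathLaw {K : RMDP A} (π : K.Policy) :
    (n : ℕ) → List K.State → K.State → PMF (Fin (n + 1) → K.State)
  | 0, _, s => PMF.pure fun _ => s
  | n + 1, h, s => (π.next h s).bind fun s' =>
      (π.pathLaw n (h ++ [s]) s').map fun σ => (Fin.cons s σ : Fin (n + 2) → K.State)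

/-- `P^max` of an event that concerns the first `k` steps of the paths that start in `s`. -/
noncomputable def RMDP.maxProb (K : RMDP A) (k : ℕ) (s : K.State)
    (Γ : Set (Fin (k + 1) → K.State)) : ℝ≥0∞ :=
  ⨆ π : K.Policy, (π.pathLaw k [] s).toOuterMeasure Γ

/-! ### The fragment `L^FG` of relational pCTL -/

/-- The temporal operators Finally and Globally. -/
inductive Op where
  | F
  | G

/-- The formulae `P_{≥ α} Op^{≤ k} φ` of `L^FG`, for a given threshold and step bound; `φ` is a
nonempty finite conjunction of atoms in `AR`. -/
@[ext] structure Formula (A : Alphabet.{u}) (α : unitInterval) (k : ℕ) where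
  op : Op
  conj : Finset (Atom A (Term A))
  nonempty : conj.Nonempty

variable {α : unitInterval} {k : ℕ}

/-- The length of a formula: the number of atoms in its state formula. -/
def Formula.length (Ψ : Formula A α k) : ℕ := Ψ.conj.card

/-- `θ` grounds all variables of `φ`, under object identity. -/
def Grounding (θ : Subst A) (φ : Set (Atom A (Term A))) : Prop :=
  (∀ x ∈ varsOf φ, ∃ c, θ x = Term.const c) ∧ ObjectIdentity θ φ

/-- `s ⊨^θ φ` for a conjunction `φ`. -/
def RMDP.Holds (K : RMDP A) (θ : Subst A) (φ : Set (Atom A (Term A))) (s : K.State) : Prop :=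
  ∀ a ∈ φ, a.subst θ ∈ s.conj

/-- `σ ⊨^θ Op^{≤ k} φ` for a path `σ = s₀, …, s_k`. -/
def RMDP.PathSat (K : RMDP A) (θ : Subst A) (φ : Set (Atom A (Term A)))
    (σ : Fin (k + 1) → K.State) : Op → Prop
  | .F => ∃ i, K.Holds θ φ (σ i)
  | .G => ∀ i, K.Holds θ φ (σ i)

/-- `s ⊨ Ψ`. -/
def RMDP.Sat (K : RMDP A) (s : K.State) (Ψ : Formula A α k) : Prop :=
  ∃ θ : Subst A, Grounding θ Ψ.conj ∧
    ENNReal.ofReal α ≤ K.maxProb k s {σ | K.PathSat θ Ψ.conj σ Ψ.op}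

/-- `Ψ` is consistent with the positive examples `Epos` and the negative examples `Eneg`. -/
def RMDP.Consistent (K : RMDP A) (Epos Eneg : Set (AbstractState A)) (Ψ : Formula A α k) : Prop :=
  (∀ e ∈ Epos, ∀ s : K.State, OISubsumed s.conj e → K.Sat s Ψ) ∧
  (∀ e ∈ Eneg, ∀ s : K.State, OISubsumed s.conj e → ¬ K.Sat s Ψ)

/-- `Sat_K(Ψ)`, the answer of the model checker: the abstract states that satisfy `Ψ`, that is,
all of whose represented states satisfy `Ψ`. -/
def RMDP.SatAbstract (K : RMDP A) (Ψ : Formula A α k) : Set (AbstractState A) :=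
  {e | ∀ s : K.State, OISubsumed s.conj e → K.Sat s Ψ}

/-! ### Refinement operators -/

/-- Candidates of the search: the formulae of `L^FG` and the top (empty) formula `⊤`. -/
abbrev Candidate (A : Alphabet.{u}) (α : unitInterval) (k : ℕ) := WithTop (Formula A α k)

/-- The states that satisfy a candidate; every state satisfies `⊤`. -/
def RMDP.Mod (K : RMDP A) : Candidate A α k → Set K.State
  | ⊤ => Set.univ
  | (Ψ : Formula A α k) => {s | K.Sat s Ψ}

/-- `Ψ' ≼_FG Ψ`. -/
def RMDP.SubsumedFG (K : RMDP A) (Ψ' Ψ : Candidate A α k) : Prop := K.Mod Ψ' ⊆ K.Mod Ψ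

/-- The operator of a candidate; the search starts with Eventually-formulae. -/
def Candidate.op : Candidate A α k → Op
  | ⊤ => .F
  | (Ψ : Formula A α k) => Ψ.op

/-- The conjunction of a candidate; it is empty for `⊤`. -/
def Candidate.conj : Candidate A α k → Finset (Atom A (Term A))
  | ⊤ => ∅
  | (Ψ : Formula A α k) => Ψ.conj

/-- `a` is an atom `r(X₁, …, X_m)` with pairwise different variables that do not occur in `φ`. -/
def FreshAtom (φ : Finset (Atom A (Term A))) (a : Atom A (Term A)) : Prop :=
  ∃ x : Fin (A.arity a.rel) → ℕ, Function.Injective x ∧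
    ∀ i, a.args i = .var (x i) ∧ x i ∉ varsOf (φ : Set (Atom A (Term A)))

open Classical in
/-- Lengthening: add one atom, with fresh variables, to the conjunction. -/
def refineLen (Ψ : Candidate A α k) : Set (Formula A α k) :=
  {Ψ' | Ψ'.op = Ψ.op ∧ ∃ a, FreshAtom Ψ.conj a ∧ a ∉ Ψ.conj ∧ Ψ'.conj = insert a Ψ.conj}

open Classical in
/-- Lengthening followed by unification: add one atom with fresh variables and unify variables of
this atom with variables or constants that are already present. -/
def refineLenUni (Ψ : Candidate A α k) : Set (Formula A α k) :=
  {Ψ' | Ψ'.op = Ψ.op ∧ ∃ a, FreshAtom Ψ.conj a ∧ ∃ τ : Subst A,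
    (∀ x ∈ varsOf {a}, τ x ∈ termsOf (insert a (Ψ.conj : Set (Atom A (Term A))))) ∧
    a.subst τ ∉ Ψ.conj ∧ Ψ'.conj = insert (a.subst τ) Ψ.conj}

open Classical in
/-- Instantiation: replace one variable by a new constant. -/
def refineIns (Ψ : Candidate A α k) : Set (Formula A α k) :=
  {Ψ' | Ψ'.op = Ψ.op ∧ ∃ x ∈ varsOf (Ψ.conj : Set (Atom A (Term A))),
    ∃ c, c ∉ constsOf (Ψ.conj : Set (Atom A (Term A))) ∧
    Ψ'.conj = Ψ.conj.image (Atom.subst (Function.update Term.var x (.const c)))}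

/-- Globalization: change an Eventually-formula to a Globally-formula. -/
def refineGlo (Ψ : Candidate A α k) : Set (Formula A α k) :=
  {Ψ' | Ψ ≠ ⊤ ∧ Ψ.op = .F ∧ Ψ'.op = .G ∧ Ψ'.conj = Ψ.conj}

/-- All refinements by the operations Len (with or without Uni), Ins and Glo. -/
def allRefinements (Ψ : Candidate A α k) : Set (Formula A α k) :=
  refineLen Ψ ∪ refineLenUni Ψ ∪ refineIns Ψ ∪ refineGlo Ψ

/-- `ρ` is a refinement operator for the search: all its refinements arise by the operations
Len, Uni, Ins and Glo. To avoid duplicates it may leave some of these refinements out. -/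
def IsRefinementOperator (ρ : Candidate A α k → Set (Formula A α k)) : Prop :=
  ∀ Ψ, ρ Ψ ⊆ allRefinements Ψ

/-- The `n`-step refinements `ρ^n(Ψ)`. -/
def refineIter (ρ : Candidate A α k → Set (Formula A α k)) :
    ℕ → Candidate A α k → Set (Candidate A α k)
  | 0, Ψ => {Ψ}
  | n + 1, Ψ => {Ψ' | ∃ Ψ'' ∈ refineIter ρ n Ψ, ∃ χ ∈ ρ Ψ'', Ψ' = (χ : Candidate A α k)}

/-- Completeness of `ρ`: `⋃ r, ρ^r(⊤) = {Ψ' | Ψ' ≼_FG ⊤}`. -/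
def IsComplete (K : RMDP A) (ρ : Candidate A α k → Set (Formula A α k)) : Prop :=
  ⋃ r, refineIter ρ r ⊤ = {Ψ' | K.SubsumedFG Ψ' ⊤}

open Classical in
/-- `Ψ'` arises from `Ψ` by a renaming of variables. -/
def Variant (Ψ Ψ' : Formula A α k) : Prop :=
  Ψ'.op = Ψ.op ∧ ∃ π : Equiv.Perm ℕ, Ψ'.conj = Ψ.conj.image (Atom.subst fun x => .var (π x))

/-- Completeness of `ρ` when formulae that differ only in the names of their variables are
identified: of every `Ψ' ≼_FG ⊤` in `L^FG` a variant is generated. -/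
def IsCompleteUpToRenaming (K : RMDP A) (ρ : Candidate A α k → Set (Formula A α k)) : Prop :=
  ∀ Ψ : Formula A α k, K.SubsumedFG (Ψ : Candidate A α k) ⊤ →
    ∃ Ψ', Variant Ψ Ψ' ∧ (Ψ' : Candidate A α k) ∈ ⋃ r, refineIter ρ r ⊤

/-! ### The algorithm Learn-pCTL -/

/-- The input of the algorithm (besides `α`, `k` and the length test): the RMDP, the examples, the
refinement operator, and the domain knowledge, given as the set of sensible formulae. -/
structure Input (A : Alphabet.{u}) (α : unitInterval) (k : ℕ) where
  K : RMDP A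
  Epos : Set (AbstractState A)
  Eneg : Set (AbstractState A)
  ρ : Candidate A α k → Set (Formula A α k)
  sensible : Set (Formula A α k)

/-- The check against the positive examples. -/
def Input.PosCheck (I : Input A α k) (Ψ : Formula A α k) : Prop :=
  ∀ e ∈ I.Epos, ∃ e' ∈ I.K.SatAbstract Ψ, OISubsumed e e'

/-- The check against the negative examples. -/
def Input.NegCheck (I : Input A α k) (Ψ : Formula A α k) : Prop :=
  ∀ e ∈ I.Eneg, ¬ ∃ e' ∈ I.K.SatAbstract Ψ, OISubsumed e e'

/-- A length test decides whether the search may proceed from `Ψ` to its refinement `Ψ'`. -/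
abbrev LengthTest (A : Alphabet.{u}) (α : unitInterval) (k : ℕ) :=
  Formula A α k → Formula A α k → Prop

/-- No candidates longer than `ℓ` are generated. -/
def maxLengthTest (ℓ : ℕ) : LengthTest A α k := fun _ Ψ' => Ψ'.length ≤ ℓ

/-- Only candidates shorter than `ℓ` are refined at all. -/
def strictLengthTest (ℓ : ℕ) : LengthTest A α k := fun Ψ _ => Ψ.length < ℓ

/-- `I.Search test Ψ χ`: the call `Search(Ψ)` returns a set of solutions that contains `χ`. -/
inductive Input.Search (I : Input A α k) (test : LengthTest A α k) :
    Formula A α k → Formula A α k → Prop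
  | add {Ψ : Formula A α k} : Ψ ∈ I.sensible → I.PosCheck Ψ → I.NegCheck Ψ → I.Search test Ψ Ψ
  | recurse {Ψ Ψ' χ : Formula A α k} : Ψ ∈ I.sensible → I.PosCheck Ψ →
      Ψ' ∈ I.ρ Ψ → test Ψ Ψ' → I.Search test Ψ' χ → I.Search test Ψ χ

/-- The set of solutions returned by Learn-pCTL, which calls `Search` on the lengthenings of `⊤`
that `ρ` produces. -/
def Input.learn (I : Input A α k) (test : LengthTest A α k) : Set (Formula A α k) :=
  {χ | ∃ Ψ ∈ I.ρ ⊤ ∩ (refineLen ⊤ ∪ refineLenUni ⊤), I.Search test Ψ χ}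

/-- The candidates generated during the run of Learn-pCTL: those on which `Search` is called. -/
inductive Input.Generated (I : Input A α k) (test : LengthTest A α k) : Formula A α k → Prop
  | start {Ψ : Formula A α k} :
      Ψ ∈ I.ρ ⊤ ∩ (refineLen ⊤ ∪ refineLenUni ⊤) → I.Generated test Ψ
  | recurse {Ψ Ψ' : Formula A α k} : I.Generated test Ψ → Ψ ∈ I.sensible → I.PosCheck Ψ →
      Ψ' ∈ I.ρ Ψ → test Ψ Ψ' → I.Generated test Ψ'

/-- Learn-pCTL generates and returns `Ψ`. -/
def Input.Finds (I : Input A α k) (test : LengthTest A α k) (Ψ : Formula A α k) : Prop :=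
  I.Generated test Ψ ∧ Ψ ∈ I.learn test

end LearnPCTL

/-! The search prunes monotonically, so no ancestor of a solution is ever cut off. Each refinement
step specializes syntactically (`generalizes_of_mem_allRefinements`): a substitution under object
identity embeds the parent's conjunction in the child's, and the operator stays or is strengthened
from F to G. Hence a state satisfying the child satisfies the parent (`Formula.Generalizes.sat`),
and, since object identity forbids atoms to collapse, the parent is no longer than the child
(`Formula.Generalizes.length_le`).

Completeness of the operator yields a chain from `⊤` to the target. Every formula on it inherits
sensibility, the positive check and the length bound from the target, so the calls reach the target,
which passes the negative check by consistency. Up to renaming, the chain ends in a variant;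
variants generalize each other, so length and consistency carry over. -/

namespace LearnPCTL

/-! ### Substitutions and OI-subsumption -/

/-- The composition of two substitutions: first `θ`, then `σ`. -/
def Subst.comp (σ θ : Subst A) : Subst A := fun x => (θ x).subst σ

theorem Term.subst_comp (σ θ : Subst A) (t : Term A) :
    t.subst (σ.comp θ) = (t.subst θ).subst σ := by
  cases t <;> rfl

theorem Atom.subst_comp (σ θ : Subst A) (a : Atom A (Term A)) :
    a.subst (σ.comp θ) = (a.subst θ).subst σ := by
  simp [Atom.subst, Atom.map, Term.subst_comp]

theorem Term.subst_var (t : Term A) : t.subst Term.var = t := by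
  cases t <;> rfl

theorem Atom.subst_var (a : Atom A (Term A)) : a.subst Term.var = a := by
  simp [Atom.subst, Atom.map, Term.subst_var]

theorem Term.subst_mem_termsOf {θ : Subst A} {C C' : Set (Atom A (Term A))}
    (h : Atom.subst θ '' C ⊆ C') {t : Term A} (ht : t ∈ termsOf C) :
    t.subst θ ∈ termsOf C' := by
  obtain ⟨a, ha, i, rfl⟩ := ht
  exact ⟨a.subst θ, h ⟨a, ha, rfl⟩, i, rfl⟩

theorem ObjectIdentity.comp {σ θ : Subst A} {C C' : Set (Atom A (Term A))}
    (hσ : ObjectIdentity σ C') (hθ : ObjectIdentity θ C) (h : Atom.subst θ '' C ⊆ C') :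
    ObjectIdentity (σ.comp θ) C := by
  intro t ht t' ht' htt'
  rw [Term.subst_comp, Term.subst_comp] at htt'
  exact hθ ht ht' (hσ (Term.subst_mem_termsOf h ht) (Term.subst_mem_termsOf h ht') htt')

/-- Colliding atoms share their relation symbol, and injectivity on terms then identifies their
arguments. This is what makes length monotone under OI-subsumption. -/
theorem ObjectIdentity.injOn_atom {θ : Subst A} {C : Set (Atom A (Term A))}
    (hθ : ObjectIdentity θ C) : Set.InjOn (Atom.subst θ) C := by
  rintro ⟨r, x⟩ ha ⟨r', y⟩ hb hab
  simp only [Atom.subst, Atom.map, Atom.mk.injEq] at hab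
  obtain ⟨rfl, hab⟩ := hab
  congr 1
  funext i
  exact hθ ⟨_, ha, i, rfl⟩ ⟨_, hb, i, rfl⟩ (congrFun (eq_of_heq hab) i)

theorem OISubsumed.of_subset {C C' : Set (Atom A (Term A))} (h : C' ⊆ C) : OISubsumed C C' := by
  refine ⟨Term.var, fun t _ t' _ htt' => ?_, ?_⟩
  · rwa [Term.subst_var, Term.subst_var] at htt'
  · rintro _ ⟨a, ha, rfl⟩
    rw [Atom.subst_var]
    exact h ha

theorem OISubsumed.trans {C₁ C₂ C₃ : Set (Atom A (Term A))} (h : OISubsumed C₁ C₂)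
    (h' : OISubsumed C₂ C₃) : OISubsumed C₁ C₃ := by
  obtain ⟨σ, hσ, hσC⟩ := h
  obtain ⟨θ, hθ, hθC⟩ := h'
  refine ⟨σ.comp θ, hσ.comp hθ hθC, ?_⟩
  rintro _ ⟨a, ha, rfl⟩
  rw [Atom.subst_comp]
  exact hσC ⟨_, hθC ⟨a, ha, rfl⟩, rfl⟩

theorem OISubsumed.card_le {φ ψ : Finset (Atom A (Term A))}
    (h : OISubsumed (φ : Set (Atom A (Term A))) ψ) : ψ.card ≤ φ.card := by
  obtain ⟨θ, hθ, h⟩ := h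
  exact Finset.card_le_card_of_injOn (Atom.subst θ) (fun a ha => h ⟨a, ha, rfl⟩) hθ.injOn_atom

theorem Grounding.subst_eq_const {θ : Subst A} {φ : Set (Atom A (Term A))} (h : Grounding θ φ)
    {t : Term A} (ht : t ∈ termsOf φ) : ∃ c, t.subst θ = Term.const c := by
  cases t with
  | var x => exact h.1 x ht
  | const c => exact ⟨c, rfl⟩

theorem Grounding.comp {σ θ : Subst A} {φ ψ : Set (Atom A (Term A))} (h : Grounding σ φ)
    (hθ : ObjectIdentity θ ψ) (hsub : Atom.subst θ '' ψ ⊆ φ) : Grounding (σ.comp θ) ψ :=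
  ⟨fun _ hx => h.subst_eq_const (Term.subst_mem_termsOf hsub hx), h.2.comp hθ hsub⟩

/-- Replacing a variable by a constant that does not occur respects object identity. -/
theorem objectIdentity_update {φ : Set (Atom A (Term A))} (x : ℕ) {c : A.D}
    (hc : c ∉ constsOf φ) : ObjectIdentity (Function.update Term.var x (Term.const c)) φ := by
  classical
  have key : ∀ t ∈ termsOf φ, t.subst (Function.update Term.var x (Term.const c)) =
      if t = .var x then .const c else t := by
    intro t _
    cases t with
    | var y => by_cases h : y = x <;> simp [Term.subst, h]
    | const d => simp [Term.subst]
  have hc' : ∀ t ∈ termsOf φ, t ≠ .const c := by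
    rintro t ht rfl
    exact hc ht
  intro t ht t' ht' h
  rw [key t ht, key t' ht'] at h
  split_ifs at h with h₁ h₂ h₂
  -- In the two mixed cases the constant `c` would already occur in `φ`.
  · rw [h₁, h₂]
  · exact absurd h.symm (hc' t' ht')
  · exact absurd h (hc' t ht)
  · exact h

theorem objectIdentity_perm (π : Equiv.Perm ℕ) (φ : Set (Atom A (Term A))) :
    ObjectIdentity (fun x => .var (π x)) φ := by
  intro t _ t' _ h
  cases t <;> cases t' <;> simp_all [Term.subst]

/-! ### Syntactic generality -/

/-- `Ψ` is syntactically more general than `Ψ'`: its conjunction OI-subsumes that of `Ψ'`, and the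
operator is the same or weaker. -/
def Formula.Generalizes (Ψ Ψ' : Formula A α k) : Prop :=
  OISubsumed (Ψ'.conj : Set (Atom A (Term A))) Ψ.conj ∧ (Ψ.op = Ψ'.op ∨ Ψ.op = .F)

theorem Formula.Generalizes.length_le {Ψ Ψ' : Formula A α k} (h : Ψ.Generalizes Ψ') :
    Ψ.length ≤ Ψ'.length :=
  h.1.card_le

theorem RMDP.PathSat.finally {K : RMDP A} {θ : Subst A} {φ : Set (Atom A (Term A))}
    {p : Fin (k + 1) → K.State} {o : Op} (h : K.PathSat θ φ p o) : K.PathSat θ φ p .F := by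
  cases o with
  | F => exact h
  -- Position 0 exists even when the step bound is 0.
  | G => exact ⟨0, h 0⟩

theorem RMDP.PathSat.mono {K : RMDP A} {θ θ' : Subst A} {φ ψ : Set (Atom A (Term A))}
    {p : Fin (k + 1) → K.State} {o : Op} (h : ∀ s, K.Holds θ φ s → K.Holds θ' ψ s)
    (hp : K.PathSat θ φ p o) : K.PathSat θ' ψ p o := by
  cases o with
  | F => exact hp.imp fun i => h _
  | G => exact fun i => h _ (hp i)

theorem RMDP.maxProb_mono (K : RMDP A) (s : K.State) {Γ Γ' : Set (Fin (k + 1) → K.State)}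
    (h : Γ ⊆ Γ') : K.maxProb k s Γ ≤ K.maxProb k s Γ' :=
  iSup_mono fun π => (π.pathLaw k [] s).toOuterMeasure.mono h

/-- Composing the embedding with a grounding for the specific formula grounds the general one. Each
path good for the former is then good for the latter, so the event grows and the supremum over
policies cannot drop. -/
theorem Formula.Generalizes.sat {Ψ Ψ' : Formula A α k} (h : Ψ.Generalizes Ψ') {K : RMDP A}
    {s : K.State} (hs : K.Sat s Ψ') : K.Sat s Ψ := by
  obtain ⟨⟨θ, hθ, hsub⟩, hop⟩ := h
  obtain ⟨σ, hσ, hp⟩ := hs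
  refine ⟨σ.comp θ, hσ.comp hθ hsub, hp.trans (K.maxProb_mono s fun p hp => ?_)⟩
  have hp' : K.PathSat (σ.comp θ) Ψ.conj p Ψ'.op := by
    refine RMDP.PathSat.mono (fun s hs a ha => ?_) hp
    rw [Atom.subst_comp]
    exact hs _ (hsub ⟨a, ha, rfl⟩)
  rcases hop with hop | hop
  · exact hop ▸ hp'
  · exact hop ▸ hp'.finally

/-- Len and Uni leave the old atoms untouched (unification acts on the added atom only), so
inclusion suffices. Ins embeds by its own binding, injective because the constant is new; Glo
changes only the operator. -/
theorem generalizes_of_mem_allRefinements {Ψ Ψ' : Formula A α k}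
    (h : Ψ' ∈ allRefinements (Ψ : Candidate A α k)) : Ψ.Generalizes Ψ' := by
  classical
  rcases h with ((⟨hop, a, -, -, hc⟩ | ⟨hop, a, -, τ, -, -, hc⟩) | ⟨hop, x, -, c, hc, h⟩) |
    ⟨-, hop, -, hc⟩
  · exact ⟨.of_subset (by rw [hc, Finset.coe_insert]; exact Set.subset_insert _ _), .inl hop.symm⟩
  · exact ⟨.of_subset (by rw [hc, Finset.coe_insert]; exact Set.subset_insert _ _), .inl hop.symm⟩
  · exact ⟨⟨_, objectIdentity_update x hc, by rw [h, Finset.coe_image]; exact subset_rfl⟩,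
      .inl hop.symm⟩
  · exact ⟨.of_subset (by rw [hc]; exact subset_rfl), .inr hop⟩

/-- Ins needs a variable and Glo excludes `⊤`, so starting the search from lengthenings alone loses
nothing. -/
theorem allRefinements_top :
    allRefinements (⊤ : Candidate A α k) ⊆ refineLen ⊤ ∪ refineLenUni ⊤ := by
  rintro Ψ ((h | h) | h)
  · exact h
  · obtain ⟨-, x, ⟨a, ha, -⟩, -⟩ := h
    exact absurd ha (Finset.notMem_empty a)
  · exact absurd rfl h.1

theorem Variant.generalizes {Ψ Ψ' : Formula A α k} (h : Variant Ψ Ψ') : Ψ.Generalizes Ψ' := by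
  classical
  obtain ⟨hop, π, hc⟩ := h
  exact ⟨⟨_, objectIdentity_perm π _, by rw [hc, Finset.coe_image]⟩, .inl hop.symm⟩

theorem Variant.symm {Ψ Ψ' : Formula A α k} (h : Variant Ψ Ψ') : Variant Ψ' Ψ := by
  classical
  obtain ⟨hop, π, hc⟩ := h
  refine ⟨hop.symm, π.symm, ?_⟩
  have key : (Atom.subst (A := A) fun x => .var (π.symm x)) ∘ (Atom.subst fun x => .var (π x)) =
      id := by
    funext a
    have : (Subst.comp (A := A) (fun x => .var (π.symm x)) fun x => .var (π x)) = Term.var := by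
      funext x
      simp [Subst.comp, Term.subst]
    rw [Function.comp_apply, ← Atom.subst_comp, this, Atom.subst_var, id]
  rw [hc, Finset.image_image, key, Finset.image_id]

theorem Variant.length_eq {Ψ Ψ' : Formula A α k} (h : Variant Ψ Ψ') : Ψ'.length = Ψ.length :=
  le_antisymm h.symm.generalizes.length_le h.generalizes.length_le

theorem RMDP.Consistent.variant {K : RMDP A} {Epos Eneg : Set (AbstractState A)}
    {Ψ Ψ' : Formula A α k} (hΨ : K.Consistent Epos Eneg Ψ) (h : Variant Ψ Ψ') :
    K.Consistent Epos Eneg Ψ' :=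
  ⟨fun e he s hs => h.symm.generalizes.sat (hΨ.1 e he s hs),
    fun e he s hs hsat => hΨ.2 e he s hs (h.generalizes.sat hsat)⟩

/-! ### The search -/

theorem Input.posCheck_of_sat {I : Input A α k} {Ψ : Formula A α k}
    (h : ∀ e ∈ I.Epos, ∀ s : I.K.State, OISubsumed s.conj e → I.K.Sat s Ψ) : I.PosCheck Ψ :=
  fun e he => ⟨e, h e he, .of_subset subset_rfl⟩

/-- A state represented by `e` is, by transitivity, represented by any `e'` with `e ≼ e'`, and so
would satisfy `Ψ`. An `e` representing no state would lie in `SatAbstract` vacuously and fail the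
check. -/
theorem Input.negCheck_of_not_sat {I : Input A α k} {Ψ : Formula A α k}
    (hEneg : ∀ e ∈ I.Eneg, ∃ s : I.K.State, OISubsumed s.conj e)
    (h : ∀ e ∈ I.Eneg, ∀ s : I.K.State, OISubsumed s.conj e → ¬ I.K.Sat s Ψ) :
    I.NegCheck Ψ := by
  rintro e he ⟨e', he', hee'⟩
  obtain ⟨s, hs⟩ := hEneg e he
  exact h e he s hs (he' s (hs.trans hee'))

/-- A solution found by an inner call is passed back through the chain of calls that generated it.
-/
theorem Input.Generated.mem_learn {I : Input A α k} {test : LengthTest A α k}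
    {Ψ χ : Formula A α k} (hΨ : I.Generated test Ψ) (h : I.Search test Ψ χ) :
    χ ∈ I.learn test := by
  induction hΨ with
  | start hρ => exact ⟨_, hρ, h⟩
  | recurse _ hsens hpos hρ htest ih => exact ih (.recurse hsens hpos hρ htest h)

/-- Induction backwards along the chain. Only the positive half of consistency is assumed, since
ancestors may well cover negative examples; the bound `m` is kept separate from the length of `Ψ` so
that it stays fixed in the induction. -/
theorem Input.generated_of_mem_refineIter {I : Input A α k} {test : LengthTest A α k} {m : ℕ}
    (hρ : IsRefinementOperator I.ρ)
    (hsens : ∀ Ψ Ψ' : Formula A α k, Ψ' ∈ I.ρ Ψ → Ψ' ∈ I.sensible → Ψ ∈ I.sensible)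
    (htest : ∀ Ψ Ψ' : Formula A α k, Ψ.length ≤ m → Ψ'.length ≤ m → test Ψ Ψ') {n : ℕ}
    {Ψ : Formula A α k} (hn : (Ψ : Candidate A α k) ∈ refineIter I.ρ n ⊤)
    (hΨ : Ψ ∈ I.sensible)
    (hpos : ∀ e ∈ I.Epos, ∀ s : I.K.State, OISubsumed s.conj e → I.K.Sat s Ψ)
    (hm : Ψ.length ≤ m) : I.Generated test Ψ := by
  induction n generalizing Ψ with
  | zero => exact absurd hn (WithTop.coe_ne_top)
  | succ n ih =>
    obtain ⟨C, hC, Ψ', hΨ', heq⟩ := hn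
    obtain rfl := WithTop.coe_injective heq
    induction C using WithTop.recTopCoe with
    -- The initial calls are subject to no length test.
    | top => exact .start ⟨hΨ', allRefinements_top (hρ _ hΨ')⟩
    | coe Φ =>
      have hgen := generalizes_of_mem_allRefinements (hρ _ hΨ')
      have hΦ := hsens Φ Ψ hΨ' hΨ
      have hposΦ : ∀ e ∈ I.Epos, ∀ s : I.K.State, OISubsumed s.conj e → I.K.Sat s Φ :=
        fun e he s hs => hgen.sat (hpos e he s hs)
      have hmΦ := hgen.length_le.trans hm
      exact .recurse (ih hC hΦ hposΦ hmΦ) hΦ (posCheck_of_sat hposΦ) hΨ' (htest _ _ hmΦ hm)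

/-- Every sensible and consistent formula that the refinement operator reaches is found, provided
that the test lets all formulae of at most its length pass. -/
theorem Input.finds_of_mem_refineIter {I : Input A α k} {test : LengthTest A α k}
    (hρ : IsRefinementOperator I.ρ)
    (hEneg : ∀ e ∈ I.Eneg, ∃ s : I.K.State, OISubsumed s.conj e)
    (hsens : ∀ Ψ Ψ' : Formula A α k, Ψ' ∈ I.ρ Ψ → Ψ' ∈ I.sensible → Ψ ∈ I.sensible)
    {Ψ : Formula A α k}
    (htest : ∀ Φ Φ' : Formula A α k, Φ.length ≤ Ψ.length → Φ'.length ≤ Ψ.length → test Φ Φ')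
    (hreach : (Ψ : Candidate A α k) ∈ ⋃ r, refineIter I.ρ r ⊤) (hΨ : Ψ ∈ I.sensible)
    (hcons : I.K.Consistent I.Epos I.Eneg Ψ) : I.Finds test Ψ := by
  obtain ⟨n, hn⟩ := Set.mem_iUnion.1 hreach
  have hgen := generated_of_mem_refineIter hρ hsens htest hn hΨ hcons.1 le_rfl
  exact ⟨hgen, hgen.mem_learn
    (.add hΨ (posCheck_of_sat hcons.1) (negCheck_of_not_sat hEneg hcons.2))⟩

theorem RMDP.subsumedFG_top (K : RMDP A) (C : Candidate A α k) : K.SubsumedFG C ⊤ :=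
  Set.subset_univ _

end LearnPCTL

theorem mainTheorem6 {A : LearnPCTL.Alphabet.{u}} (α : unitInterval) (k : ℕ)
    (I : LearnPCTL.Input A α k) (ℓ : ℕ)
    (hρ : LearnPCTL.IsRefinementOperator I.ρ)
    (hEneg : ∀ e ∈ I.Eneg, ∃ s : I.K.State, LearnPCTL.OISubsumed s.conj e)
    (hsens : ∀ Ψ Ψ' : LearnPCTL.Formula A α k, Ψ' ∈ I.ρ Ψ → Ψ' ∈ I.sensible → Ψ ∈ I.sensible) :
    (LearnPCTL.IsComplete I.K I.ρ →
      ∀ Ψ ∈ I.sensible, I.K.Consistent I.Epos I.Eneg Ψ →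
        (Ψ.length ≤ ℓ → I.Finds (LearnPCTL.maxLengthTest ℓ) Ψ) ∧
        (Ψ.length < ℓ → I.Finds (LearnPCTL.strictLengthTest ℓ) Ψ)) ∧
    (LearnPCTL.IsCompleteUpToRenaming I.K I.ρ →
      (∀ Ψ Ψ' : LearnPCTL.Formula A α k, LearnPCTL.Variant Ψ Ψ' →
        Ψ ∈ I.sensible → Ψ' ∈ I.sensible) →
      ∀ Ψ ∈ I.sensible, I.K.Consistent I.Epos I.Eneg Ψ →
        (Ψ.length ≤ ℓ →
          ∃ Ψ', LearnPCTL.Variant Ψ Ψ' ∧ I.Finds (LearnPCTL.maxLengthTest ℓ) Ψ') ∧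
        (Ψ.length < ℓ →
          ∃ Ψ', LearnPCTL.Variant Ψ Ψ' ∧ I.Finds (LearnPCTL.strictLengthTest ℓ) Ψ')) := by
  open LearnPCTL in
  have hmax : ∀ Ψ : Formula A α k, Ψ.length ≤ ℓ → ∀ Φ Φ' : Formula A α k,
      Φ.length ≤ Ψ.length → Φ'.length ≤ Ψ.length → maxLengthTest ℓ Φ Φ' :=
    fun _ h _ _ _ h' => h'.trans h
  open LearnPCTL in
  have hstrict : ∀ Ψ : Formula A α k, Ψ.length < ℓ → ∀ Φ Φ' : Formula A α k,
      Φ.length ≤ Ψ.length → Φ'.length ≤ Ψ.length → strictLengthTest ℓ Φ Φ' :=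
    fun _ h _ _ h' _ => h'.trans_lt h
  refine ⟨fun hcomp Ψ hΨ hcons => ?_, fun hcomp hvar Ψ hΨ hcons => ?_⟩
  · have hreach : (Ψ : LearnPCTL.Candidate A α k) ∈ ⋃ r, LearnPCTL.refineIter I.ρ r ⊤ := by
      rw [hcomp]
      exact I.K.subsumedFG_top _
    exact ⟨fun h => LearnPCTL.Input.finds_of_mem_refineIter hρ hEneg hsens (hmax Ψ h) hreach hΨ
        hcons,
      fun h => LearnPCTL.Input.finds_of_mem_refineIter hρ hEneg hsens (hstrict Ψ h) hreach hΨ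
        hcons⟩
  · obtain ⟨Ψ', hv, hreach⟩ := hcomp Ψ (I.K.subsumedFG_top _)
    have hΨ' := hvar Ψ Ψ' hv hΨ
    have hcons' := hcons.variant hv
    -- The length bounds now speak of the variant, as the tests along its chain require.
    rw [← hv.length_eq]
    exact ⟨fun h => ⟨Ψ', hv, LearnPCTL.Input.finds_of_mem_refineIter hρ hEneg hsens (hmax Ψ' h)
        hreach hΨ' hcons'⟩,
      fun h => ⟨Ψ', hv, LearnPCTL.Input.finds_of_mem_refineIter hρ hEneg hsens (hstrict Ψ' h)
        hreach hΨ' hcons'⟩⟩
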